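/- Let $\mathcal X=\Omega^*$ be the set of finite sequences over a vocabulary $\Omega$, let $\mathcal Y$ be a finite set of classes, $\bar f:\mathcal X\to\mathcal Y$ a base classifier, and let the deletion rate depend only on the length: $\psi(x)=\psi(|x|)\in[0,1]$. Let $q(\epsilon\mid x)=\prod_{i\le |x|}\psi(x)^{1-\epsilon_i}(1-\psi(x))^{\epsilon_i}$ for $\epsilon\in\{0,1\}^{|x|}$, let $\mathrm{apply}(x,\epsilon)$ be the subsequence of the tokens $x_i$ with $\epsilon_i=1$, and let $p_y(x)=\sum_{\epsilon}q(\epsilon\mid x)\,\mathbf 1\{\bar f(\mathrm{apply}(x,\epsilon))=y\}$. Let $f$ be a smoothed classifier, $f(x)\in\arg\max_{y}p_y(x)$, with arbitrary tie-breaking. For $o\subseteq\{\mathsf{del},\mathsf{ins},\mathsf{sub}\}$ let $\mathrm{dist}_o(x\to\tilde x)\in\mathbb N\cup\{\infty\}$ be the least number of edits of types in $o$ that transform $x$ into $\tilde x$, and for $r\in\mathbb N$ let $B_r(x;o)=\{\tilde x:\mathrm{dist}_o(x\to\tilde x)\le r\}$. **Pairwise bounds.** Put $b(m,p,k)=\binom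 mk(1-p)^kp^{m-k}$, $\lfloor a\rfloor_v=v\lfloor a/v\rfloor$, $\lceil a\rceil_v=v\lceil a/v\rceil$, and $a/0=0$. For lengths $n,\tilde n\ge m$ and rates $p,\tilde p$, a number $w$ and a set $I$ of indices let $$K_{\mathrm{rnd}}(w,H,I)=\sum_{i\in I}b(m,\tilde p,i)+b(m,\tilde p,H)\;\mathrm{rnd}_{1/\binom mH}\!\left(\frac{w-\sum_{i\in I}b(m,p,i)}{b(m,p,H)}\right).$$ Let $H_-(w)=\min\{h:\sum_{i=0}^{h}b(m,p,i)\ge w\}$ and $H_+(w)=\max\{h\le m:\sum_{i=h}^{m}b(m,p,i)\ge w\}$. With $w=\mu-1+p^{n-m}$ put $$\mathrm{lb}(\mu;n,\tilde n,m)=\frac{\tilde p^{\tilde n-m}}{p^{n-m}}\begin{cases}K_{\lfloor\cdot\rfloor}(w,H_-(w),\{0,\dots,H_-(w)-1\}),&p\ge\tilde p,\\K_{\lfloor\cdot\rfloor}(w,H_+(w),\{H_+(w)+1,\dots,m\}),&p<\tilde p,\end{cases}$$ $$\mathrm{ub}(\mu;n,\tilde n,m)=\frac{\tilde p^{\tilde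 n-m}}{p^{n-m}}\begin{cases}K_{\lceil\cdot\rceil}(\mu,H_-(\mu),\{0,\dots,H_-(\mu)-1\}),&p\le\tilde p,\\K_{\lceil\cdot\rceil}(\mu,H_+(\mu),\{H_+(\mu)+1,\dots,m\}),&p>\tilde p,\end{cases}\;+1-\tilde p^{\tilde n-m},$$ where $p=\psi(n)$, $\tilde p=\psi(\tilde n)$. **Algorithm Certify.** Input: $\bar f$, $x$, a predicted class $y_1$, $\psi$, $o$, $\alpha\in(0,1)$, and deletion vectors $\epsilon^{(1)},\dots,\epsilon^{(N)}\in\{0,1\}^{|x|}$. Let $k_y=\#\{j:\bar f(\mathrm{apply}(x,\epsilon^{(j)}))=y\}$. Let $t_1$ be the Clopper–Pearson lower bound at level $\alpha/2$ for $k_{y_1}$ successes, and $t_2$ the maximum over $y\ne y_1$ of the Clopper–Pearson upper bounds at level $\alpha/2$ for $k_y$ successes in $N$ trials; that is, the bounds for $k$ successes are $\inf\{q\in[0,1]:\Pr[\mathrm{Bin}(N,q)\ge k]>\alpha/2\}$ and $\sup\{q\in[0,1]:\Pr[\mathrm{Bin}(N,q)\le k]>\alpha/2\}$ (and $t_2=0$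 if $\mathcal Y=\{y_1\}$). For $r=0,1,2,\dots$, the check at $r$ fails if for some $(n_{\mathsf{del}},n_{\mathsf{ins}},n_{\mathsf{sub}})\in\mathbb N^3$ with $n_{\mathsf{del}}+n_{\mathsf{ins}}+n_{\mathsf{sub}}=r$, with $n_e=0$ for $e\notin o$, and with $n_{\mathsf{del}}+n_{\mathsf{sub}}\le|x|$, one has $$\mathrm{lb}(t_1;|x|,\tilde n,m)\le \mathrm{ub}(t_2;|x|,\tilde n,m),\qquad \tilde n=|x|+n_{\mathsf{ins}}-n_{\mathsf{del}},\quad m=|x|-n_{\mathsf{del}}-n_{\mathsf{sub}}.$$ If $r_0$ is the first radius at which the check fails, the output is $R=\max(r_0-1,0)$; if no check fails, $R=\infty$. **Theorem.** Let $\epsilon^{(1)},\dots,\epsilon^{(N)}$ be independent with law $q(\cdot\mid x)$, and let $y_1$ be a (possibly random) class that is independent of $(\epsilon^{(1)},\dots,\epsilon^{(N)})$. Then, with probability at least $1-\alpha$, for every $r\in\mathbb N$ with $r\le R$, $$\forall\,\tilde x\in B_r(x;o):\quad f(x)=f(\tilde x).$$ -/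

import Mathlib

section AdaptiveDeletion

/-- The token-level edit operations. -/
inductive EditOp : Type
  | del
  | ins
  | sub

/-- `EditStep o u v`: the sequence `v` results from `u` by one edit whose type lies in `o`. -/
inductive EditStep {V : Type*} (o : Set EditOp) : List V → List V → Prop
  | del (l r : List V) (a : V) (h : EditOp.del ∈ o) : EditStep o (l ++ a :: r) (l ++ r)
  | ins (l r : List V) (a : V) (h : EditOp.ins ∈ o) : EditStep o (l ++ r) (l ++ a :: r)
  | sub (l r : List V) (a b : V) (h : EditOp.sub ∈ o) : EditStep o (l ++ a :: r) (l ++ b :: r)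

/-- `EditChain o n u v`: `u` is transformed into `v` by `n` successive edits of types in `o`. -/
inductive EditChain {V : Type*} (o : Set EditOp) : ℕ → List V → List V → Prop
  | refl (u : List V) : EditChain o 0 u u
  | tail {n : ℕ} {u v w : List V} (h : EditChain o n u v) (s : EditStep o v w) :
      EditChain o (n + 1) u w

/-- The directed edit distance: the least number of edits of types in `o` that transform `u`
into `v`; it is `⊤` if no sequence of such edits does. -/
noncomputable def editDist {V : Type*} (o : Set EditOp) (u v : List V) : ℕ∞ :=
  sInf {k : ℕ∞ | ∃ n : ℕ, k = n ∧ EditChain o n u v}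

/-- The edit distance ball of radius `r` centered on `x`. -/
def editBall {V : Type*} (o : Set EditOp) (r : ℕ) (x : List V) : Set (List V) :=
  {x' | editDist o x x' ≤ (r : ℕ∞)}

/-- The space of deletion indicators of `x`; `true` retains a token and `false` deletes it. -/
abbrev DelInd {V : Type*} (x : List V) : Type := Fin x.length → Bool

/-- The subsequence of `x` that consists of the tokens retained by `ε`. -/
def applyDel {V : Type*} (x : List V) (ε : DelInd x) : List V :=
  ((List.finRange x.length).filter (fun i => ε i)).map x.get

/-- The probability mass of the indicator vector `ε` when every token of `x` is deleted
independently with probability `ψ x`. -/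
noncomputable def delMass {V : Type*} (ψ : List V → ℝ) (x : List V) (ε : DelInd x) : ℝ :=
  ∏ i, if ε i = true then 1 - ψ x else ψ x

open scoped Classical in
/-- The smoothed class probability of `y` at `x`: the probability that the base classifier
outputs `y` on the random subsequence of `x`. -/
noncomputable def smoothedProb {V Y : Type*} (base : List V → Y) (ψ : List V → ℝ) (y : Y)
    (x : List V) : ℝ :=
  ∑ ε : DelInd x, delMass ψ x ε * (if base (applyDel x ε) = y then 1 else 0)

/-- `f` is a smoothed classifier: it outputs a class of maximal smoothed probability. Ties may be
broken in any way. -/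
def IsSmoothedClassifier {V Y : Type*} (base : List V → Y) (ψ : List V → ℝ)
    (f : List V → Y) : Prop :=
  ∀ (x : List V) (y : Y), smoothedProb base ψ y x ≤ smoothedProb base ψ (f x) x

/-- Probability mass at `k` of the number of retained tokens among `n`, if each token is deleted
with probability `p`. -/
noncomputable def retainMass (n : ℕ) (p : ℝ) (k : ℕ) : ℝ :=
  (n.choose k : ℝ) * (1 - p) ^ k * p ^ (n - k)

/-- Rounding down to a multiple of `v`. -/
noncomputable def gridFloor (v a : ℝ) : ℝ := (⌊a / v⌋ : ℝ) * v

/-- Rounding up to a multiple of `v`. -/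
noncomputable def gridCeil (v a : ℝ) : ℝ := (⌈a / v⌉ : ℝ) * v

/-- The least `h` such that retaining at most `h` of `m` tokens has probability at least `w`. -/
noncomputable def threshMin (m : ℕ) (p w : ℝ) : ℕ :=
  sInf {h : ℕ | w ≤ ∑ i ∈ Finset.range (h + 1), retainMass m p i}

/-- The greatest `h ≤ m` such that retaining at least `h` of `m` tokens has probability at least
`w`. -/
noncomputable def threshMax (m : ℕ) (p w : ℝ) : ℕ :=
  sSup {h : ℕ | h ≤ m ∧ w ≤ ∑ i ∈ Finset.Icc h m, retainMass m p i}

/-- The common part of the two pairwise bounds: the sum over the index set `I` of the masses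
at rate `p'`, plus the rounded fraction of the mass at the threshold `H`. -/
noncomputable def knapsackSum (rnd : ℝ → ℝ → ℝ) (m : ℕ) (p p' w : ℝ) (H : ℕ) (I : Finset ℕ) : ℝ :=
  (∑ i ∈ I, retainMass m p' i) +
    retainMass m p' H *
      rnd ((m.choose H : ℝ)⁻¹) ((w - ∑ i ∈ I, retainMass m p i) / retainMass m p H)

open scoped Classical in
/-- The pairwise lower bound on the smoothed class probability at a sequence of length `n'` with
deletion rate `p'`, when the sequence shares a common subsequence of length `m` with a sequence of
length `n`, deletion rate `p` and smoothed class probability `μ`. -/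
noncomputable def pairLB (μ : ℝ) (n n' m : ℕ) (p p' : ℝ) : ℝ :=
  let w : ℝ := μ - 1 + p ^ (n - m)
  p' ^ (n' - m) / p ^ (n - m) *
    (if p' ≤ p then
      knapsackSum gridFloor m p p' w (threshMin m p w) (Finset.range (threshMin m p w))
    else
      knapsackSum gridFloor m p p' w (threshMax m p w) (Finset.Ioc (threshMax m p w) m))

open scoped Classical in
/-- The pairwise upper bound, with the arguments of `pairLB`. -/
noncomputable def pairUB (μ : ℝ) (n n' m : ℕ) (p p' : ℝ) : ℝ :=
  p' ^ (n' - m) / p ^ (n - m) *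
    (if p ≤ p' then
      knapsackSum gridCeil m p p' μ (threshMin m p μ) (Finset.range (threshMin m p μ))
    else
      knapsackSum gridCeil m p p' μ (threshMax m p μ) (Finset.Ioc (threshMax m p μ) m))
    + 1 - p' ^ (n' - m)

/-- The binomial probability mass function with `N` trials and success probability `q`. -/
noncomputable def binomMass (N : ℕ) (q : ℝ) (k : ℕ) : ℝ :=
  (N.choose k : ℝ) * q ^ k * (1 - q) ^ (N - k)

/-- The one-sided Clopper-Pearson lower confidence bound at level `1 - δ` for a success
probability, given `k` successes in `N` trials. -/
noncomputable def cpLower (N k : ℕ) (δ : ℝ) : ℝ :=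
  sInf {q : ℝ | q ∈ Set.Icc (0 : ℝ) 1 ∧ δ < ∑ i ∈ Finset.Icc k N, binomMass N q i}

/-- The one-sided Clopper-Pearson upper confidence bound at level `1 - δ` for a success
probability, given `k` successes in `N` trials. -/
noncomputable def cpUpper (N k : ℕ) (δ : ℝ) : ℝ :=
  sSup {q : ℝ | q ∈ Set.Icc (0 : ℝ) 1 ∧ δ < ∑ i ∈ Finset.range (k + 1), binomMass N q i}

/-- The possible numbers `(n_del, n_ins, n_sub)` of edits of each type at radius `r`. -/
def editCounts (o : Set EditOp) (r : ℕ) : Set (ℕ × ℕ × ℕ) :=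
  {c | c.1 + c.2.1 + c.2.2 = r ∧ (EditOp.del ∉ o → c.1 = 0) ∧ (EditOp.ins ∉ o → c.2.1 = 0) ∧
    (EditOp.sub ∉ o → c.2.2 = 0)}

/-- The check at radius `r` for an input of length `n` fails: for some counts of edits the lower
bound for the predicted class does not exceed the upper bound for the other classes. Counts with
`n_del + n_sub > n` do not occur for any sequence and are skipped. A sequence that is obtained with
the given counts has length `n + n_ins - n_del`, and it shares with the input a subsequence of
length `n - n_del - n_sub`. -/
def CheckFails (o : Set EditOp) (ψ : ℕ → ℝ) (n : ℕ) (t₁ t₂ : ℝ) (r : ℕ) : Prop :=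
  ∃ nd ni ns : ℕ, (nd, ni, ns) ∈ editCounts o r ∧ nd + ns ≤ n ∧
    pairLB t₁ n (n + ni - nd) (n - nd - ns) (ψ n) (ψ (n + ni - nd)) ≤
      pairUB t₂ n (n + ni - nd) (n - nd - ns) (ψ n) (ψ (n + ni - nd))

open scoped Classical in
/-- The radius found by the search over `r = 0, 1, 2, …`: the last radius before the first failed
check (`0` if already the check at radius `0` fails), and `⊤` if no check ever fails. -/
noncomputable def searchRadius (o : Set EditOp) (ψ : ℕ → ℝ) (n : ℕ) (t₁ t₂ : ℝ) : ℕ∞ :=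
  if h : ∃ r, CheckFails o ψ n t₁ t₂ r then ((Nat.find h - 1 : ℕ) : ℕ∞) else ⊤

open scoped Classical in
/-- The number of sampled subsequences of `x` that the base classifier assigns to the class `y`. -/
noncomputable def voteCount {V Y : Type*} (base : List V → Y) (x : List V) {N : ℕ}
    (E : Fin N → DelInd x) (y : Y) : ℕ :=
  (Finset.univ.filter (fun j => base (applyDel x (E j)) = y)).card

/-- The certification algorithm, as a function of the Monte Carlo sample `E`. -/
noncomputable def certify {V Y : Type*} (base : List V → Y) (x : List V) (y₁ : Y) (ψ : ℕ → ℝ)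
    (o : Set EditOp) (α : ℝ) {N : ℕ} (E : Fin N → DelInd x) : ℕ∞ :=
  searchRadius o ψ x.length
    (cpLower N (voteCount base x E y₁) (α / 2))
    (⨆ y : {y : Y // y ≠ y₁}, cpUpper N (voteCount base x E y) (α / 2))

end AdaptiveDeletion

/-!
Let `c` be a common subsequence of `x` and `x'`, and write `p`, `p'` for the deletion rates at `x`
and `x'`. With probability `p ^ (|x| - |c|)` all tokens of `x` outside `c` are deleted, and then the
random subsequence of `x` is a random subsequence of `c`; the same holds for `x'`. So the class
probabilities at `x` and `x'` are both controlled by those at `c`, at the rates `p` and `p'`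
(`pow_mul_delExp_le_of_sublist`, `delExp_le_of_sublist`). The latter are mixtures of the binomial
masses `retainMass` with weights in `[0, 1]` that do not depend on the rate
(`exists_delExp_eq_sum_retainMass`). Given the value of such a mixture at rate `p`, its extreme
values at rate `p'` are those of a fractional knapsack, which is solved by filling the levels in the
order of their likelihood ratios, as in the Neyman-Pearson lemma (`knapsack_le_sum`,
`sum_le_knapsack`, `retainMass_mul_le`). Rounding only weakens the result, hence `pairLB` and
`pairUB` are valid bounds (`pairLB_le_delExp`, `delExp_le_pairUB`).

Validity needs `p > 0`, and a positive upper bound on the class probability at `x`. Both are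
harmless: if `p = 0`, then already the check at radius `0` fails, because a Clopper-Pearson lower
bound is less than `1` (`pairLB_zero_le_pairUB_zero`), and the certified radius is `0`; and a
Clopper-Pearson upper bound is positive (`cpUpper_pos`).

A sequence in the ball arises from at most `r` edits. The counts examined by the checks are obtained
from an arbitrary chain of edits by `EditChain.exists_counts`, together with the common subsequence
`c`. A successful check then makes the probability of the predicted class strictly larger than that
of every other class, throughout the ball (`eq_of_mem_editBall_of_boundsCorrect`).

For a fixed class `y` the confidence bounds are correct with probability `1 - α`
(`one_sub_le_measureReal_boundsCorrect`): the vote counts are binomial, and the maximum of the upper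
bounds over the other classes only has to dominate the probability of the runner-up, a fixed class.
Independence of `y₁` and the sample allows averaging this over the values of `y₁`.
-/

/-! ### Expectations over random deletions -/

/-- The expectation of `φ` on the random subsequence of `x` from which every token is deleted
independently with probability `ρ`. -/
noncomputable def delExp {V : Type*} (ρ : ℝ) (φ : List V → ℝ) (x : List V) : ℝ :=
  ∑ ε : DelInd x, delMass (fun _ => ρ) x ε * φ (applyDel x ε)

open scoped Classical in
lemma smoothedProb_eq_delExp {V Y : Type*} (base : List V → Y) (ψ : List V → ℝ) (y : Y)
    (x : List V) :
    smoothedProb base ψ y x = delExp (ψ x) (fun z => if base z = y then 1 else 0) x := rfl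

lemma applyDel_cons {V : Type*} (a : V) (x : List V) (b : Bool) (δ : DelInd x) :
    applyDel (a :: x) (Fin.cons b δ : Fin (x.length + 1) → Bool) =
      if b = true then a :: applyDel x δ else applyDel x δ := by
  have h : ((List.finRange x.length).map Fin.succ).filter
      (fun i => (Fin.cons b δ : Fin (x.length + 1) → Bool) i) =
      ((List.finRange x.length).filter (fun i => δ i)).map Fin.succ := by
    rw [List.filter_map]
    congr 1
  have h2 : (((List.finRange x.length).filter (fun i => δ i)).map Fin.succ).map (a :: x).get =
      applyDel x δ := by
    rw [List.map_map]
    rfl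
  change List.map (a :: x).get (List.filter
    (fun i => (Fin.cons b δ : Fin (x.length + 1) → Bool) i) (List.finRange (x.length + 1))) = _
  rw [List.finRange_succ]
  cases b
  · rw [List.filter_cons_of_neg (by simp), if_neg (by simp)]
    exact (congrArg (List.map (a :: x).get) h).trans h2
  · rw [List.filter_cons_of_pos (by simp), if_pos rfl]
    exact (congrArg (fun l => List.map (a :: x).get (0 :: l)) h).trans (congrArg (List.cons a) h2)

lemma delMass_cons {V : Type*} (ρ : ℝ) (a : V) (x : List V) (b : Bool) (δ : DelInd x) :
    delMass (fun _ => ρ) (a :: x) (Fin.cons b δ : Fin (x.length + 1) → Bool) =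
      (if b = true then 1 - ρ else ρ) * delMass (fun _ => ρ) x δ := by
  unfold delMass
  exact (Fin.prod_univ_succ _).trans (by simp)

lemma delExp_nil {V : Type*} (ρ : ℝ) (φ : List V → ℝ) : delExp ρ φ [] = φ [] := by
  unfold delExp
  rw [Fintype.sum_eq_single (fun i => i.elim0)]
  · simp [delMass, applyDel]
  · intro ε hε
    exact absurd (funext fun i => i.elim0) hε

lemma delExp_cons {V : Type*} (ρ : ℝ) (φ : List V → ℝ) (a : V) (x : List V) :
    delExp ρ φ (a :: x) = ρ * delExp ρ φ x + (1 - ρ) * delExp ρ (fun z => φ (a :: z)) x := by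
  have h : delExp ρ φ (a :: x) = ∑ bδ : Bool × DelInd x,
      delMass (fun _ => ρ) (a :: x) (Fin.cons bδ.1 bδ.2 : Fin (x.length + 1) → Bool) *
        φ (applyDel (a :: x) (Fin.cons bδ.1 bδ.2 : Fin (x.length + 1) → Bool)) :=
    ((Fin.consEquiv (fun _ : Fin (x.length + 1) => Bool)).sum_comp
      (fun ε : DelInd (a :: x) =>
        delMass (fun _ => ρ) (a :: x) ε * φ (applyDel (a :: x) ε))).symm
  rw [h, Fintype.sum_prod_type, Fintype.sum_bool]
  simp only [delMass_cons, applyDel_cons]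
  simp only [delExp, Finset.mul_sum, if_true, Bool.false_eq_true, if_false]
  rw [add_comm]
  congr 1 <;> exact Finset.sum_congr rfl fun _ _ => by ring

lemma delExp_const {V : Type*} (ρ c : ℝ) (x : List V) : delExp ρ (fun _ => c) x = c := by
  induction x with
  | nil => exact delExp_nil _ _
  | cons a x ih => rw [delExp_cons, ih]; ring

lemma delExp_one_sub {V : Type*} (ρ : ℝ) (φ : List V → ℝ) (x : List V) :
    delExp ρ (fun z => 1 - φ z) x = 1 - delExp ρ φ x := by
  have h := delExp_const ρ 1 x
  unfold delExp at h ⊢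
  simp only [mul_sub, Finset.sum_sub_distrib, h]

lemma delMass_nonneg {V : Type*} {ρ : ℝ} (h0 : 0 ≤ ρ) (h1 : ρ ≤ 1) (x : List V) (ε : DelInd x) :
    0 ≤ delMass (fun _ => ρ) x ε :=
  Finset.prod_nonneg fun i _ => by split_ifs <;> linarith

lemma delExp_nonneg {V : Type*} {ρ : ℝ} (h0 : 0 ≤ ρ) (h1 : ρ ≤ 1) {φ : List V → ℝ}
    (hφ : ∀ z, 0 ≤ φ z) (x : List V) : 0 ≤ delExp ρ φ x :=
  Finset.sum_nonneg fun ε _ => mul_nonneg (delMass_nonneg h0 h1 x ε) (hφ _)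

lemma delExp_le_one {V : Type*} {ρ : ℝ} (h0 : 0 ≤ ρ) (h1 : ρ ≤ 1) {φ : List V → ℝ}
    (hφ : ∀ z, φ z ≤ 1) (x : List V) : delExp ρ φ x ≤ 1 := by
  have := delExp_nonneg h0 h1 (φ := fun z => 1 - φ z) (fun z => sub_nonneg.2 (hφ z)) x
  rw [delExp_one_sub] at this
  linarith

/-- With probability `ρ ^ (|x| - |c|)` all tokens of `x` outside the subsequence `c` are deleted,
and then the remaining deletions act on `c`. -/
lemma pow_mul_delExp_le_of_sublist {V : Type*} {ρ : ℝ} (h0 : 0 ≤ ρ) (h1 : ρ ≤ 1) {c x : List V}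
    (h : c.Sublist x) : ∀ {φ : List V → ℝ}, (∀ z, 0 ≤ φ z) →
      ρ ^ (x.length - c.length) * delExp ρ φ c ≤ delExp ρ φ x := by
  induction h with
  | slnil => intro φ _; simp
  | @cons c x a h ih =>
    intro φ hφ
    rw [delExp_cons, List.length_cons, Nat.sub_add_comm h.length_le, pow_succ']
    have h3 := delExp_nonneg h0 h1 (φ := fun z => φ (a :: z)) (fun z => hφ _) x
    have h4 := mul_le_mul_of_nonneg_left (ih hφ) h0
    nlinarith [mul_nonneg (sub_nonneg.2 h1) h3]
  | @cons_cons c x a h ih =>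
    intro φ hφ
    rw [delExp_cons, delExp_cons, List.length_cons, List.length_cons, Nat.add_sub_add_right]
    have h3 := mul_le_mul_of_nonneg_left (ih hφ) h0
    have h4 := mul_le_mul_of_nonneg_left (ih (φ := fun z => φ (a :: z)) fun z => hφ _)
      (sub_nonneg.2 h1)
    linarith

lemma delExp_le_of_sublist {V : Type*} {ρ : ℝ} (h0 : 0 ≤ ρ) (h1 : ρ ≤ 1) {c x : List V}
    (h : c.Sublist x) {φ : List V → ℝ} (hφ : ∀ z, φ z ≤ 1) :
    delExp ρ φ x ≤
      ρ ^ (x.length - c.length) * delExp ρ φ c + 1 - ρ ^ (x.length - c.length) := by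
  have := pow_mul_delExp_le_of_sublist h0 h1 h (φ := fun z => 1 - φ z)
    (fun z => sub_nonneg.2 (hφ z))
  rw [delExp_one_sub, delExp_one_sub] at this
  linarith

lemma delMass_eq_pow {V : Type*} (ρ : ℝ) (x : List V) (ε : DelInd x) :
    delMass (fun _ => ρ) x ε =
      (1 - ρ) ^ (Finset.univ.filter fun i => ε i = true).card *
        ρ ^ (x.length - (Finset.univ.filter fun i => ε i = true).card) := by
  unfold delMass
  rw [Finset.prod_ite, Finset.prod_const, Finset.prod_const, ← Finset.compl_filter,
    Finset.card_compl, Fintype.card_fin]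

/-- Grouping the indicator vectors by the number of retained tokens expresses an expectation as a
mixture of the masses `retainMass`, with weights that do not depend on the deletion rate. -/
lemma exists_delExp_eq_sum_retainMass {V : Type*} {φ : List V → ℝ} (hφ0 : ∀ z, 0 ≤ φ z)
    (hφ1 : ∀ z, φ z ≤ 1) (x : List V) :
    ∃ h : ℕ → ℝ, (∀ i, 0 ≤ h i) ∧ (∀ i, h i ≤ 1) ∧
      ∀ ρ, delExp ρ φ x = ∑ i ∈ Finset.range (x.length + 1), h i * retainMass x.length ρ i := by
  classical
  let cnt : DelInd x → ℕ := fun ε => (Finset.univ.filter fun i => ε i = true).card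
  let a : ℕ → ℝ := fun i => ∑ ε ∈ Finset.univ.filter (fun ε => cnt ε = i), φ (applyDel x ε)
  have ha0 : ∀ i, 0 ≤ a i := fun i => Finset.sum_nonneg fun _ _ => hφ0 _
  have ha1 : ∀ i, a i ≤ x.length.choose i := by
    intro i
    have h1 : a i ≤ ((Finset.univ.filter (fun ε => cnt ε = i)).card : ℝ) := by
      refine (Finset.sum_le_card_nsmul _ _ 1 fun _ _ => hφ1 _).trans ?_
      simp
    refine h1.trans ?_
    have h2 : (Finset.univ.filter (fun ε => cnt ε = i)).card ≤
        (Finset.powersetCard i (Finset.univ : Finset (Fin x.length))).card := by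
      refine Finset.card_le_card_of_injOn (fun ε => Finset.univ.filter fun j => ε j = true) ?_ ?_
      · intro ε hε
        simpa [cnt] using hε
      · intro ε _ δ _ h
        funext j
        have := Finset.ext_iff.1 h j
        simp only [Finset.mem_filter, Finset.mem_univ, true_and] at this
        exact Bool.eq_iff_iff.2 this
    rw [Finset.card_powersetCard, Finset.card_univ, Fintype.card_fin] at h2
    exact_mod_cast h2
  refine ⟨fun i => a i / x.length.choose i, fun i => div_nonneg (ha0 i) (Nat.cast_nonneg _),
    fun i => div_le_one_of_le₀ (ha1 i) (Nat.cast_nonneg _), fun ρ => ?_⟩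
  have hmaps : ∀ ε ∈ (Finset.univ : Finset (DelInd x)), cnt ε ∈ Finset.range (x.length + 1) := by
    intro ε _
    have := Finset.card_le_univ (Finset.univ.filter fun i => ε i = true)
    rw [Fintype.card_fin] at this
    exact Finset.mem_range.2 (Nat.lt_succ_of_le this)
  unfold delExp
  rw [← Finset.sum_fiberwise_of_maps_to hmaps]
  refine Finset.sum_congr rfl fun i hi => ?_
  have hc : (x.length.choose i : ℝ) ≠ 0 :=
    Nat.cast_ne_zero.2 (Nat.choose_pos (Nat.lt_succ_iff.1 (Finset.mem_range.1 hi))).ne'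
  have : a i / x.length.choose i * retainMass x.length ρ i =
      a i * ((1 - ρ) ^ i * ρ ^ (x.length - i)) := by
    unfold retainMass
    field_simp
  rw [this, Finset.sum_mul]
  refine Finset.sum_congr rfl fun ε hε => ?_
  rw [delMass_eq_pow, show (Finset.univ.filter fun i => ε i = true).card = i from
    (Finset.mem_filter.1 hε).2, mul_comm]

/-! ### The fractional knapsack -/

/-- Neyman-Pearson for masses `u`, `v` on levels: if the levels in `I` have the smallest ratios
`v / u` and `H` is the threshold level, filling `I` and then a part of `H` is the cheapest way to
collect mass `w`. -/
lemma knapsack_le_sum {s I : Finset ℕ} (hI : I ⊆ s) {u v h : ℕ → ℝ} {H : ℕ} {w : ℝ}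
    (hu : 0 < u H) (hv : 0 ≤ v H) (h0 : ∀ i, 0 ≤ h i) (h1 : ∀ i, h i ≤ 1)
    (hin : ∀ i ∈ I, u H * v i ≤ v H * u i)
    (hout : ∀ i ∈ s, i ∉ I → v H * u i ≤ u H * v i) (hw : w ≤ ∑ i ∈ s, h i * u i) :
    ∑ i ∈ I, v i + v H * ((w - ∑ i ∈ I, u i) / u H) ≤ ∑ i ∈ s, h i * v i := by
  have key : 0 ≤ ∑ i ∈ s, (h i - if i ∈ I then 1 else 0) * (u H * v i - v H * u i) := by
    refine Finset.sum_nonneg fun i hi => ?_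
    split_ifs with hiI
    · exact mul_nonneg_of_nonpos_of_nonpos (by linarith [h1 i]) (by linarith [hin i hiI])
    · exact mul_nonneg (by linarith [h0 i]) (by linarith [hout i hi hiI])
  have hsum : ∀ g : ℕ → ℝ, ∑ i ∈ s, (if i ∈ I then (1 : ℝ) else 0) * g i = ∑ i ∈ I, g i := by
    intro g
    simp only [ite_mul, one_mul, zero_mul]
    rw [← Finset.sum_filter, Finset.filter_mem_eq_inter, Finset.inter_eq_right.2 hI]
  have expand : ∑ i ∈ s, (h i - if i ∈ I then 1 else 0) * (u H * v i - v H * u i) =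
      u H * ∑ i ∈ s, h i * v i - v H * ∑ i ∈ s, h i * u i -
        (u H * ∑ i ∈ I, v i - v H * ∑ i ∈ I, u i) := by
    simp only [sub_mul, Finset.sum_sub_distrib]
    rw [hsum]
    simp only [mul_sub, Finset.sum_sub_distrib, Finset.mul_sum]
    congr 2 <;> exact Finset.sum_congr rfl fun _ _ => by ring
  rw [expand] at key
  have hvw := mul_le_mul_of_nonneg_left hw hv
  refine le_of_mul_le_mul_left ?_ hu
  have : u H * (∑ i ∈ I, v i + v H * ((w - ∑ i ∈ I, u i) / u H)) =
      u H * ∑ i ∈ I, v i + v H * (w - ∑ i ∈ I, u i) := by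
    field_simp
  rw [this]
  linarith

/-- The maximization counterpart of `knapsack_le_sum`. -/
lemma sum_le_knapsack {s I : Finset ℕ} (hI : I ⊆ s) {u v h : ℕ → ℝ} {H : ℕ} {w : ℝ}
    (hu : 0 < u H) (hv : 0 ≤ v H) (h0 : ∀ i, 0 ≤ h i) (h1 : ∀ i, h i ≤ 1)
    (hin : ∀ i ∈ I, v H * u i ≤ u H * v i)
    (hout : ∀ i ∈ s, i ∉ I → u H * v i ≤ v H * u i) (hw : ∑ i ∈ s, h i * u i ≤ w) :
    ∑ i ∈ s, h i * v i ≤ ∑ i ∈ I, v i + v H * ((w - ∑ i ∈ I, u i) / u H) := by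
  -- Exchanging the roles of chosen and unchosen mass turns the levels outside `I` into those
  -- to be filled first.
  have key := knapsack_le_sum (s := s) (I := s \ I) (u := u) (v := v) (h := fun i => 1 - h i)
    (H := H) (w := ∑ i ∈ s, u i - w) Finset.sdiff_subset hu hv
    (fun i => by linarith [h1 i]) (fun i => by linarith [h0 i])
    (fun i hi => hout i (Finset.mem_sdiff.1 hi).1 (Finset.mem_sdiff.1 hi).2)
    (fun i hi hn => hin i (by by_contra h; exact hn (Finset.mem_sdiff.2 ⟨hi, h⟩)))
    (by simp only [sub_mul, one_mul, Finset.sum_sub_distrib]; linarith)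
  have hs := fun g : ℕ → ℝ => Finset.sum_sdiff (f := g) hI
  have e : (∑ i ∈ s, u i - w - ∑ i ∈ s \ I, u i) / u H = - ((w - ∑ i ∈ I, u i) / u H) := by
    rw [← hs u]; ring
  simp only [sub_mul, one_mul, Finset.sum_sub_distrib] at key
  rw [e, mul_neg, ← hs v] at key
  linarith

lemma gridFloor_le {v a : ℝ} (hv : 0 < v) : gridFloor v a ≤ a :=
  (mul_le_mul_of_nonneg_right (Int.floor_le (a / v)) hv.le).trans_eq (div_mul_cancel₀ a hv.ne')

lemma le_gridCeil {v a : ℝ} (hv : 0 < v) : a ≤ gridCeil v a :=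
  (div_mul_cancel₀ a hv.ne').symm.trans_le
    (mul_le_mul_of_nonneg_right (Int.le_ceil (a / v)) hv.le)

/-! ### Retention masses and thresholds -/

lemma retainMass_nonneg {p : ℝ} (h0 : 0 ≤ p) (h1 : p ≤ 1) (m i : ℕ) : 0 ≤ retainMass m p i :=
  mul_nonneg (mul_nonneg (Nat.cast_nonneg _) (pow_nonneg (sub_nonneg.2 h1) _)) (pow_nonneg h0 _)

lemma retainMass_pos {p : ℝ} (h0 : 0 < p) (h1 : p < 1) {m i : ℕ} (hi : i ≤ m) :
    0 < retainMass m p i :=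
  mul_pos (mul_pos (Nat.cast_pos.2 (Nat.choose_pos hi)) (pow_pos (sub_pos.2 h1) _)) (pow_pos h0 _)

lemma retainMass_one (m i : ℕ) : retainMass m 1 i = if i = 0 then 1 else 0 := by
  split_ifs with h
  · simp [retainMass, h]
  · simp [retainMass, h]

lemma sum_retainMass (m : ℕ) (p : ℝ) : ∑ i ∈ Finset.range (m + 1), retainMass m p i = 1 := by
  have := add_pow (1 - p) p m
  rw [sub_add_cancel, one_pow] at this
  rw [this]
  exact Finset.sum_congr rfl fun i _ => by unfold retainMass; ring

/-- A smaller deletion rate shifts the number of retained tokens upwards in the likelihood ratio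
order. -/
lemma retainMass_mul_le {p p' : ℝ} (h0 : 0 ≤ p') (hle : p' ≤ p) (h1 : p ≤ 1) {m i j : ℕ}
    (hij : i ≤ j) (hj : j ≤ m) :
    retainMass m p' i * retainMass m p j ≤ retainMass m p' j * retainMass m p i := by
  obtain ⟨d, rfl⟩ := Nat.exists_eq_add_of_le hij
  obtain ⟨e, rfl⟩ := Nat.exists_eq_add_of_le hj
  have hd : (p' * (1 - p)) ^ d ≤ (p * (1 - p')) ^ d :=
    pow_le_pow_left₀ (mul_nonneg h0 (by linarith)) (by nlinarith) d
  rw [mul_pow, mul_pow] at hd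
  have h1' : 0 ≤ 1 - p := sub_nonneg.2 h1
  have h2' : 0 ≤ 1 - p' := by linarith
  have h3' : 0 ≤ p := h0.trans hle
  have hC : 0 ≤ ((i + d + e).choose i : ℝ) * (i + d + e).choose (i + d) *
      ((1 - p') ^ i * (1 - p) ^ i * p' ^ e * p ^ e) := by positivity
  unfold retainMass
  rw [show i + d + e - i = d + e by omega, show i + d + e - (i + d) = e by omega]
  simp only [pow_add]
  nlinarith [mul_le_mul_of_nonneg_left hd hC]

lemma threshMin_le {m : ℕ} {p w : ℝ} (hw : w ≤ 1) : threshMin m p w ≤ m :=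
  Nat.sInf_le (by rw [Set.mem_ofPred_eq, sum_retainMass]; exact hw)

lemma threshMax_le (m : ℕ) (p w : ℝ) : threshMax m p w ≤ m :=
  csSup_le' fun _ h => h.1

lemma retainMass_threshMin_pos {m : ℕ} {p w : ℝ} (h0 : 0 < p) (h1 : p ≤ 1) (hw : w ≤ 1) :
    0 < retainMass m p (threshMin m p w) := by
  rcases h1.lt_or_eq with h1 | rfl
  · exact retainMass_pos h0 h1 (threshMin_le hw)
  · have : threshMin m 1 w = 0 :=
      Nat.le_zero.1 (Nat.sInf_le (by simpa [retainMass_one] using hw))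
    simp [this, retainMass_one]

lemma retainMass_threshMax_pos {m : ℕ} {p w : ℝ} (h0 : 0 < p) (h1 : p ≤ 1)
    (hw : p = 1 → 0 < w) : 0 < retainMass m p (threshMax m p w) := by
  rcases h1.lt_or_eq with h1 | rfl
  · exact retainMass_pos h0 h1 (threshMax_le _ _ _)
  · have : threshMax m 1 w = 0 := by
      refine Nat.le_zero.1 (csSup_le' fun h hh => ?_)
      by_contra hne
      have h2 := hh.2
      rw [Finset.sum_eq_zero] at h2
      · exact absurd (hw rfl) (not_lt.2 h2)
      · intro i hi
        rw [retainMass_one, if_neg]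
        have := (Finset.mem_Icc.1 hi).1
        omega
    simp [this, retainMass_one]

lemma retainMass_zero_of_lt {m i : ℕ} (h : i < m) : retainMass m 0 i = 0 := by
  simp [retainMass, Nat.sub_ne_zero_of_lt h]

lemma retainMass_zero_self (m : ℕ) : retainMass m 0 m = 1 := by
  simp [retainMass]

/-! ### Validity of the pairwise bounds -/

lemma choose_inv_pos {m H : ℕ} (h : H ≤ m) : (0 : ℝ) < (m.choose H : ℝ)⁻¹ :=
  inv_pos.2 (Nat.cast_pos.2 (Nat.choose_pos h))

theorem pairLB_le_delExp {V : Type*} {p p' μ : ℝ} (hp0 : 0 < p) (hp1 : p ≤ 1) (hp'0 : 0 ≤ p')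
    (hp'1 : p' ≤ 1) {φ : List V → ℝ} (hφ0 : ∀ z, 0 ≤ φ z) (hφ1 : ∀ z, φ z ≤ 1)
    {c x x' : List V} (hx : c.Sublist x) (hx' : c.Sublist x') (hμ : μ ≤ delExp p φ x) :
    pairLB μ x.length x'.length c.length p p' ≤ delExp p' φ x' := by
  obtain ⟨h, h0, h1, hh⟩ := exists_delExp_eq_sum_retainMass hφ0 hφ1 c
  refine le_trans ?_ (pow_mul_delExp_le_of_sublist hp'0 hp'1 hx' hφ0)
  have hu := hμ.trans (delExp_le_of_sublist hp0.le hp1 hx hφ1)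
  have hμ1 : μ ≤ 1 := hμ.trans (delExp_le_one hp0.le hp1 hφ1 x)
  have hP : 0 < p ^ (x.length - c.length) := pow_pos hp0 _
  have hP1 : p ^ (x.length - c.length) ≤ 1 := pow_le_one₀ hp0.le hp1
  unfold pairLB
  dsimp only
  set Q := p ^ (x.length - c.length) with hQ
  set m := c.length with hm
  set w := μ - 1 + Q with hw_def
  have hw1 : w ≤ 1 := by rw [hw_def]; linarith
  -- The weights `Q * h` are a fractional filling that collects mass at least `w` at rate `p`.
  have hw : w ≤ ∑ i ∈ Finset.range (m + 1), (Q * h i) * retainMass m p i := by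
    simp only [mul_assoc, ← Finset.mul_sum, ← hh]
    rw [hw_def]
    linarith
  have hg0 : ∀ i, 0 ≤ Q * h i := fun i => mul_nonneg hP.le (h0 i)
  have hg1 : ∀ i, Q * h i ≤ 1 := fun i => mul_le_one₀ hP1 (h0 i) (h1 i)
  suffices H : ∀ K, K ≤ ∑ i ∈ Finset.range (m + 1), (Q * h i) * retainMass m p' i →
      p' ^ (x'.length - m) / Q * K ≤ p' ^ (x'.length - m) * delExp p' φ c by
    apply H
    have hv := fun H => retainMass_nonneg hp'0 hp'1 m H
    split_ifs with hpp
    · have hH := threshMin_le (m := m) (p := p) hw1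
      refine le_trans ?_ (knapsack_le_sum (I := Finset.range (threshMin m p w))
        (Finset.range_mono (by omega)) (retainMass_threshMin_pos hp0 hp1 hw1) (hv _) hg0 hg1
        ?_ ?_ hw)
      · exact add_le_add_right (mul_le_mul_of_nonneg_left
          (gridFloor_le (choose_inv_pos hH)) (hv _)) _
      · intro i hi
        rw [mul_comm]
        exact retainMass_mul_le hp'0 hpp hp1 (Finset.mem_range.1 hi).le hH
      · intro i hi hn
        rw [mul_comm (retainMass m p _)]
        rw [Finset.mem_range] at hi hn
        exact retainMass_mul_le hp'0 hpp hp1 (by omega) (by omega)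
    · push Not at hpp
      have hH := threshMax_le m p w
      refine le_trans ?_ (knapsack_le_sum (I := Finset.Ioc (threshMax m p w) m)
        (fun i hi => Finset.mem_range.2 (Nat.lt_succ_of_le (Finset.mem_Ioc.1 hi).2))
        (retainMass_threshMax_pos (w := w) hp0 hp1 fun h => by linarith) (hv _) hg0 hg1 ?_ ?_ hw)
      · exact add_le_add_right (mul_le_mul_of_nonneg_left
          (gridFloor_le (choose_inv_pos hH)) (hv _)) _
      · intro i hi
        rw [mul_comm (retainMass m p' _)]
        rw [Finset.mem_Ioc] at hi
        exact retainMass_mul_le hp0.le hpp.le hp'1 hi.1.le hi.2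
      · intro i hi hn
        rw [mul_comm]
        rw [Finset.mem_range] at hi
        rw [Finset.mem_Ioc] at hn
        exact retainMass_mul_le hp0.le hpp.le hp'1 (by omega) hH
  intro K hK
  refine (mul_le_mul_of_nonneg_left hK (div_nonneg (pow_nonneg hp'0 _) hP.le)).trans_eq ?_
  simp only [mul_assoc, ← Finset.mul_sum, ← hh]
  field_simp

/-- The hypothesis `0 < μ` matters at `p = 1`: there the threshold for `μ = 0` ignores the levels
of mass zero. -/
theorem delExp_le_pairUB {V : Type*} {p p' μ : ℝ} (hp0 : 0 < p) (hp1 : p ≤ 1) (hp'0 : 0 ≤ p')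
    (hp'1 : p' ≤ 1) {φ : List V → ℝ} (hφ0 : ∀ z, 0 ≤ φ z) (hφ1 : ∀ z, φ z ≤ 1)
    {c x x' : List V} (hx : c.Sublist x) (hx' : c.Sublist x') (hμ : delExp p φ x ≤ μ)
    (hμ0 : 0 < μ) (hμ1 : μ ≤ 1) :
    delExp p' φ x' ≤ pairUB μ x.length x'.length c.length p p' := by
  obtain ⟨h, h0, h1, hh⟩ := exists_delExp_eq_sum_retainMass hφ0 hφ1 c
  refine (delExp_le_of_sublist hp'0 hp'1 hx' hφ1).trans ?_
  have hu := (pow_mul_delExp_le_of_sublist hp0.le hp1 hx hφ0).trans hμ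
  have hP : 0 < p ^ (x.length - c.length) := pow_pos hp0 _
  have hP1 : p ^ (x.length - c.length) ≤ 1 := pow_le_one₀ hp0.le hp1
  unfold pairUB
  set Q := p ^ (x.length - c.length) with hQ
  set m := c.length with hm
  refine sub_le_sub_right (add_le_add_left ?_ 1) _
  have hw : ∑ i ∈ Finset.range (m + 1), (Q * h i) * retainMass m p i ≤ μ := by
    simpa only [mul_assoc, ← Finset.mul_sum, ← hh] using hu
  have hg0 : ∀ i, 0 ≤ Q * h i := fun i => mul_nonneg hP.le (h0 i)
  have hg1 : ∀ i, Q * h i ≤ 1 := fun i => mul_le_one₀ hP1 (h0 i) (h1 i)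
  suffices H : ∀ K, ∑ i ∈ Finset.range (m + 1), (Q * h i) * retainMass m p' i ≤ K →
      p' ^ (x'.length - m) * delExp p' φ c ≤ p' ^ (x'.length - m) / Q * K by
    apply H
    have hv := fun H => retainMass_nonneg hp'0 hp'1 m H
    split_ifs with hpp
    · have hH := threshMin_le (m := m) (p := p) hμ1
      refine (sum_le_knapsack (I := Finset.range (threshMin m p μ))
        (Finset.range_mono (by omega)) (retainMass_threshMin_pos hp0 hp1 hμ1) (hv _) hg0 hg1
        ?_ ?_ hw).trans ?_
      · intro i hi
        rw [mul_comm]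
        exact retainMass_mul_le hp0.le hpp hp'1 (Finset.mem_range.1 hi).le hH
      · intro i hi hn
        rw [mul_comm (retainMass m p' _)]
        rw [Finset.mem_range] at hi hn
        exact retainMass_mul_le hp0.le hpp hp'1 (by omega) (by omega)
      · exact add_le_add_right (mul_le_mul_of_nonneg_left
          (le_gridCeil (choose_inv_pos hH)) (hv _)) _
    · push Not at hpp
      have hH := threshMax_le m p μ
      refine (sum_le_knapsack (I := Finset.Ioc (threshMax m p μ) m)
        (fun i hi => Finset.mem_range.2 (Nat.lt_succ_of_le (Finset.mem_Ioc.1 hi).2))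
        (retainMass_threshMax_pos hp0 hp1 fun _ => hμ0) (hv _) hg0 hg1 ?_ ?_ hw).trans ?_
      · intro i hi
        rw [mul_comm (retainMass m p _)]
        rw [Finset.mem_Ioc] at hi
        exact retainMass_mul_le hp'0 hpp.le hp1 hi.1.le hi.2
      · intro i hi hn
        rw [mul_comm]
        rw [Finset.mem_range] at hi
        rw [Finset.mem_Ioc] at hn
        exact retainMass_mul_le hp'0 hpp.le hp1 (by omega) hH
      · exact add_le_add_right (mul_le_mul_of_nonneg_left
          (le_gridCeil (choose_inv_pos hH)) (hv _)) _
  intro K hK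
  refine Eq.trans_le ?_ (mul_le_mul_of_nonneg_left hK (div_nonneg (pow_nonneg hp'0 _) hP.le))
  simp only [mul_assoc, ← Finset.mul_sum, ← hh]
  field_simp

/-- At deletion rate `0` the only level of positive mass is that of `n` retained tokens. Its grid
consists of the integers, so a lower bound below `1` for the class probability is rounded down to
a trivial one. -/
lemma pairLB_zero_le_pairUB_zero {t₁ t₂ : ℝ} (n : ℕ) (h₁ : t₁ < 1) (h₂ : 0 ≤ t₂) (h₂' : t₂ ≤ 1) :
    pairLB t₁ n n n 0 0 ≤ pairUB t₂ n n n 0 0 := by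
  have hsum : ∀ H ≤ n, ∑ i ∈ Finset.range H, retainMass n 0 i = 0 := fun H hH =>
    Finset.sum_eq_zero fun i hi =>
      retainMass_zero_of_lt ((Finset.mem_range.1 hi).trans_le hH)
  have hL : ∀ H ≤ n, knapsackSum gridFloor n 0 0 t₁ H (Finset.range H) ≤ 0 := by
    intro H hH
    unfold knapsackSum
    rw [hsum H hH]
    rcases hH.lt_or_eq with h | rfl
    · simp [retainMass_zero_of_lt h]
    · have : ⌊t₁⌋ ≤ 0 := Int.lt_add_one_iff.1 (Int.floor_lt.2 (by simpa using h₁))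
      simpa [retainMass_zero_self, gridFloor] using this
  have hU : ∀ H ≤ n, 0 ≤ knapsackSum gridCeil n 0 0 t₂ H (Finset.range H) := by
    intro H hH
    unfold knapsackSum
    rw [hsum H hH]
    rcases hH.lt_or_eq with h | rfl
    · simp [retainMass_zero_of_lt h]
    · have : 0 ≤ ⌈t₂⌉ := Int.ceil_nonneg h₂
      simpa [retainMass_zero_self, gridCeil] using this
  have h1 := hL _ (threshMin_le (p := 0) h₁.le)
  have h2 := hU _ (threshMin_le (p := 0) h₂')
  simp only [pairLB, pairUB, Nat.sub_self, pow_zero, div_one, one_mul, le_refl, if_true,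
    sub_add_cancel, add_sub_cancel_right]
  exact h1.trans h2

/-! ### Edits and common subsequences -/

lemma exists_sublist_of_sublist_middle {V : Type*} {c l r : List V} {a : V}
    (h : c.Sublist (l ++ a :: r)) :
    c.Sublist (l ++ r) ∨
      ∃ c' : List V, c'.Sublist c ∧ c'.length + 1 = c.length ∧ c'.Sublist (l ++ r) := by
  obtain ⟨c₁, c₂, rfl, h₁, h₂⟩ := List.sublist_append_iff.1 h
  rcases List.sublist_cons_iff.1 h₂ with h₂ | ⟨c₃, rfl, h₃⟩
  · exact Or.inl (h₁.append h₂)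
  · refine Or.inr ⟨c₁ ++ c₃, (List.Sublist.refl _).append (List.sublist_cons_self _ _), ?_,
      h₁.append h₃⟩
    simp only [List.length_append, List.length_cons]
    omega

lemma sublist_append_cons {V : Type*} (l r : List V) (a : V) : (l ++ r).Sublist (l ++ a :: r) :=
  (List.Sublist.refl _).append (List.sublist_cons_self _ _)

/-- A chain of edits can undo its own work, so the numbers of edits of each type in the chain need
not be admissible counts. Admissible ones are obtained by following the length of the sequence and
of a subsequence shared with `x`: a deletion that leaves this subsequence intact is charged to an
earlier substitution or insertion, and a substitution that does so is not counted. -/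
lemma EditChain.exists_counts {V : Type*} {o : Set EditOp} {k : ℕ} {x v : List V}
    (h : EditChain o k x v) :
    ∃ nd ni ns : ℕ, nd + ni + ns ≤ k ∧ (EditOp.del ∉ o → nd = 0) ∧ (EditOp.ins ∉ o → ni = 0) ∧
      (EditOp.sub ∉ o → ns = 0) ∧ v.length + nd = x.length + ni ∧
      ∃ c : List V, c.Sublist x ∧ c.Sublist v ∧ c.length + nd + ns = x.length := by
  induction h with
  | refl u => exact ⟨0, 0, 0, by simp, by simp, by simp, by simp, rfl, u, by simp⟩
  | @tail k u v w _ s ih =>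
    obtain ⟨nd, ni, ns, hk, hd, hi, hs, hlen, c, hcx, hcv, hc⟩ := ih
    cases s with
    | del l r a ho =>
      simp only [List.length_append, List.length_cons] at hlen ⊢
      rcases exists_sublist_of_sublist_middle hcv with hcw | ⟨c', hc', hl, hcw⟩
      · have hle := hcw.length_le
        rw [List.length_append] at hle
        by_cases hns : ns = 0
        · refine ⟨nd, ni - 1, ns, by omega, hd, fun h => by simp [hi h], hs, by omega, c, hcx,
            hcw, hc⟩
        · refine ⟨nd + 1, ni, ns - 1, by omega, fun h => absurd ho h, hi,
            fun h => by simp [hs h], by omega, c, hcx, hcw, by omega⟩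
      · exact ⟨nd + 1, ni, ns, by omega, fun h => absurd ho h, hi, hs, by omega, c',
          hc'.trans hcx, hcw, by omega⟩
    | ins l r a ho =>
      simp only [List.length_append, List.length_cons] at hlen ⊢
      exact ⟨nd, ni + 1, ns, by omega, hd, fun h => absurd ho h, hs, by omega, c, hcx,
        hcv.trans (sublist_append_cons _ _ _), hc⟩
    | sub l r a b ho =>
      simp only [List.length_append, List.length_cons] at hlen ⊢
      rcases exists_sublist_of_sublist_middle hcv with hcw | ⟨c', hc', hl, hcw⟩
      · exact ⟨nd, ni, ns, by omega, hd, hi, hs, by omega, c, hcx,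
          hcw.trans (sublist_append_cons _ _ _), hc⟩
      · exact ⟨nd, ni, ns + 1, by omega, hd, hi, fun h => absurd ho h, by omega, c',
          hc'.trans hcx, hcw.trans (sublist_append_cons _ _ _), by omega⟩

lemma exists_editChain_of_mem_editBall {V : Type*} {o : Set EditOp} {r : ℕ} {x x' : List V}
    (h : x' ∈ editBall o r x) : ∃ k ≤ r, EditChain o k x x' := by
  have h' : sInf {k : ℕ∞ | ∃ n : ℕ, k = n ∧ EditChain o n x x'} ≤ (r : ℕ∞) := h
  rcases Set.eq_empty_or_nonempty {k : ℕ∞ | ∃ n : ℕ, k = n ∧ EditChain o n x x'} with he | hne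
  · rw [he, sInf_empty] at h'
    exact absurd h' (by simp)
  · obtain ⟨n, hn, hch⟩ := csInf_mem hne
    rw [hn] at h'
    exact ⟨n, by exact_mod_cast h', hch⟩

lemma editChain_zero {V : Type*} {o : Set EditOp} {x x' : List V} (h : EditChain o 0 x x') :
    x' = x := by
  cases h
  rfl

/-! ### Clopper-Pearson bounds -/

lemma binomMass_nonneg {q : ℝ} (h0 : 0 ≤ q) (h1 : q ≤ 1) (N k : ℕ) : 0 ≤ binomMass N q k :=
  mul_nonneg (mul_nonneg (Nat.cast_nonneg _) (pow_nonneg h0 _)) (pow_nonneg (sub_nonneg.2 h1) _)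

lemma continuous_sum_binomMass (N : ℕ) (s : Finset ℕ) :
    Continuous fun q => ∑ i ∈ s, binomMass N q i := by
  unfold binomMass
  fun_prop

lemma cpLower_le {N k : ℕ} {δ q : ℝ} (hq : q ∈ Set.Icc (0 : ℝ) 1)
    (h : δ < ∑ i ∈ Finset.Icc k N, binomMass N q i) : cpLower N k δ ≤ q :=
  csInf_le ⟨0, fun _ h => h.1.1⟩ ⟨hq, h⟩

lemma le_cpUpper {N k : ℕ} {δ q : ℝ} (hq : q ∈ Set.Icc (0 : ℝ) 1)
    (h : δ < ∑ i ∈ Finset.range (k + 1), binomMass N q i) : q ≤ cpUpper N k δ :=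
  le_csSup ⟨1, fun _ h => h.1.2⟩ ⟨hq, h⟩

lemma cpUpper_le_one (N k : ℕ) (δ : ℝ) : cpUpper N k δ ≤ 1 :=
  Real.sSup_le (fun _ h => h.1.2) zero_le_one

lemma cpLower_lt_one {N k : ℕ} (hk : k ≤ N) {δ : ℝ} (hδ : δ < 1) : cpLower N k δ < 1 := by
  have h1 : δ < ∑ i ∈ Finset.Icc k N, binomMass N 1 i := by
    rw [Finset.sum_eq_single_of_mem N (Finset.right_mem_Icc.2 hk)]
    · simpa [binomMass] using hδ
    · intro i hi hne
      have := (Finset.mem_Icc.1 hi).2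
      simp [binomMass, show N - i ≠ 0 by omega]
  have h2 : ∀ᶠ q in nhds (1 : ℝ), δ < ∑ i ∈ Finset.Icc k N, binomMass N q i :=
    (continuous_sum_binomMass N _).continuousAt.eventually (lt_mem_nhds h1)
  obtain ⟨q, hq, hq1⟩ := ((h2.filter_mono nhdsWithin_le_nhds).and
    (Ioo_mem_nhdsLT (zero_lt_one' ℝ))).exists
  exact (cpLower_le ⟨hq1.1.le, hq1.2.le⟩ hq).trans_lt hq1.2

lemma cpUpper_pos (N k : ℕ) {δ : ℝ} (hδ : δ < 1) : 0 < cpUpper N k δ := by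
  have h1 : δ < ∑ i ∈ Finset.range (k + 1), binomMass N 0 i := by
    rw [Finset.sum_eq_single_of_mem 0 (Finset.mem_range.2 (Nat.succ_pos k))]
    · simpa [binomMass] using hδ
    · intro i _ hne
      simp [binomMass, hne]
  have h2 : ∀ᶠ q in nhds (0 : ℝ), δ < ∑ i ∈ Finset.range (k + 1), binomMass N q i :=
    (continuous_sum_binomMass N _).continuousAt.eventually (lt_mem_nhds h1)
  obtain ⟨q, hq, hq1⟩ := ((h2.filter_mono nhdsWithin_le_nhds).and
    (Ioo_mem_nhdsGT (zero_lt_one' ℝ))).exists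
  exact hq1.1.trans_le (le_cpUpper ⟨hq1.1.le, hq1.2.le⟩ hq)

/-- The values `k` at which the lower bound exceeds `q` form an upper segment, whose binomial mass
is at most `δ`. -/
lemma sum_binomMass_cpLower_gt_le {q δ : ℝ} (hq : q ∈ Set.Icc (0 : ℝ) 1) (hδ : 0 ≤ δ) (N : ℕ) :
    ∑ k ∈ (Finset.range (N + 1)).filter (fun k => q < cpLower N k δ), binomMass N q k ≤ δ := by
  set s := (Finset.range (N + 1)).filter (fun k => q < cpLower N k δ) with hs
  rcases s.eq_empty_or_nonempty with he | hne
  · simpa [he] using hδ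
  have hmin := s.min'_mem hne
  set k₀ := s.min' hne
  have h0 : ∑ i ∈ Finset.Icc k₀ N, binomMass N q i ≤ δ := by
    by_contra! h
    exact absurd (cpLower_le hq h) (not_le.2 (Finset.mem_filter.1 hmin).2)
  refine (Finset.sum_le_sum_of_subset_of_nonneg (fun k hk => ?_)
    fun i _ _ => binomMass_nonneg hq.1 hq.2 N i).trans h0
  exact Finset.mem_Icc.2 ⟨s.min'_le k hk,
    Nat.lt_succ_iff.1 (Finset.mem_range.1 (Finset.mem_filter.1 hk).1)⟩

lemma sum_binomMass_cpUpper_lt_le {q δ : ℝ} (hq : q ∈ Set.Icc (0 : ℝ) 1) (hδ : 0 ≤ δ) (N : ℕ) :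
    ∑ k ∈ (Finset.range (N + 1)).filter (fun k => cpUpper N k δ < q), binomMass N q k ≤ δ := by
  set s := (Finset.range (N + 1)).filter (fun k => cpUpper N k δ < q) with hs
  rcases s.eq_empty_or_nonempty with he | hne
  · simpa [he] using hδ
  have hmax := s.max'_mem hne
  set k₀ := s.max' hne
  have h0 : ∑ i ∈ Finset.range (k₀ + 1), binomMass N q i ≤ δ := by
    by_contra! h
    exact absurd (le_cpUpper hq h) (not_le.2 (Finset.mem_filter.1 hmax).2)
  refine (Finset.sum_le_sum_of_subset_of_nonneg (fun k hk => ?_)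
    fun i _ _ => binomMass_nonneg hq.1 hq.2 N i).trans h0
  exact Finset.mem_range.2 (Nat.lt_succ_of_le (s.le_max' k hk))

/-! ### The law of the vote counts -/

section Sampling

open MeasureTheory ProbabilityTheory

lemma voteCount_le {V Y : Type*} (base : List V → Y) (x : List V) {N : ℕ} (e : Fin N → DelInd x)
    (y : Y) : voteCount base x e y ≤ N := by
  classical
  exact (Finset.card_le_univ _).trans_eq (Fintype.card_fin N)

lemma measureReal_base_eq {V Y S : Type*} [MeasurableSpace S] (P : Measure S)
    [IsProbabilityMeasure P] (base : List V → Y) (ψ : List V → ℝ) (x : List V) (F : S → DelInd x)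
    (hF : Measurable F) (hlaw : ∀ ε, P.real {s | F s = ε} = delMass ψ x ε) (y : Y) :
    P.real {s | base (applyDel x (F s)) = y} = smoothedProb base ψ y x := by
  classical
  have h : {s | base (applyDel x (F s)) = y} =
      ⋃ ε ∈ Finset.univ.filter (fun ε : DelInd x => base (applyDel x ε) = y), {s | F s = ε} := by
    ext s
    simp
  rw [h, measureReal_biUnion_finset]
  · unfold smoothedProb
    rw [Finset.sum_filter]
    refine Finset.sum_congr rfl fun ε _ => ?_
    rw [hlaw]
    split_ifs <;> simp
  · intro ε _ ε' _ hne
    exact Set.disjoint_left.2 fun s hs hs' => hne (hs.symm.trans hs')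
  · intro ε _
    exact hF (measurableSet_singleton ε)

lemma measureReal_voteCount_eq {V Y S : Type*} [MeasurableSpace S] (P : Measure S)
    [IsProbabilityMeasure P] (base : List V → Y) (ψ : List V → ℝ) (x : List V) (N : ℕ)
    (E : Fin N → S → DelInd x) (hE : ∀ j, Measurable (E j))
    (hE_law : ∀ j ε, P.real {s | E j s = ε} = delMass ψ x ε) (hE_indep : iIndepFun E P) (y : Y)
    (k : ℕ) :
    P.real {s | voteCount base x (fun j => E j s) y = k} =
      binomMass N (smoothedProb base ψ y x) k := by
  classical
  set q := smoothedProb base ψ y x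
  let A : Set (DelInd x) := {ε | base (applyDel x ε) = y}
  have hA : MeasurableSet A := Set.toFinite A |>.measurableSet
  let votes : S → Finset (Fin N) := fun s => Finset.univ.filter fun j => E j s ∈ A
  let B : Finset (Fin N) → Fin N → Set (DelInd x) := fun T j => if j ∈ T then A else Aᶜ
  have hB : ∀ T j, MeasurableSet (B T j) := by
    intro T j
    by_cases h : j ∈ T
    · simpa [B, h] using hA
    · simpa [B, h] using hA.compl
  have hT : ∀ T, {s | votes s = T} = ⋂ j ∈ (Finset.univ : Finset (Fin N)), E j ⁻¹' B T j := by
    intro T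
    ext s
    simp only [Set.mem_ofPred_eq, Finset.ext_iff, votes, Finset.mem_filter, Finset.mem_univ,
      true_and, Set.mem_iInter, Set.mem_preimage, forall_true_left]
    refine forall_congr' fun j => ?_
    by_cases h : j ∈ T <;> simp [B, h]
  have hmeasT : ∀ T, MeasurableSet {s | votes s = T} := by
    intro T
    rw [hT]
    exact Finset.measurableSet_biInter _ fun j _ => hE j (hB T j)
  have hPA : ∀ j, P.real (E j ⁻¹' A) = q := fun j =>
    measureReal_base_eq P base ψ x (E j) (hE j) (hE_law j) y
  have hPT : ∀ T, P.real {s | votes s = T} = q ^ T.card * (1 - q) ^ (N - T.card) := by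
    intro T
    have h1 : P.real {s | votes s = T} = ∏ j, P.real (E j ⁻¹' B T j) := by
      rw [hT, measureReal_def,
        hE_indep.measure_inter_preimage_eq_mul Finset.univ fun j _ => hB T j,
        ENNReal.toReal_prod]
      rfl
    have h2 : ∀ j, P.real (E j ⁻¹' B T j) = if j ∈ T then q else 1 - q := by
      intro j
      by_cases h : j ∈ T
      · simp [B, h, hPA]
      · simp only [B, h, if_false, Set.preimage_compl]
        rw [probReal_compl_eq_one_sub (hE j hA), hPA]
    simp only [h1, h2]
    rw [Finset.prod_ite, Finset.prod_const, Finset.prod_const, ← Finset.compl_filter,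
      Finset.card_compl, Fintype.card_fin]
    simp
  have hU : {s | voteCount base x (fun j => E j s) y = k} =
      ⋃ T ∈ Finset.powersetCard k (Finset.univ : Finset (Fin N)), {s | votes s = T} := by
    ext s
    simp only [Set.mem_ofPred_eq, Set.mem_iUnion, Finset.mem_powersetCard, Finset.subset_univ,
      true_and, exists_prop, exists_eq_right']
    rfl
  rw [hU, measureReal_biUnion_finset]
  · rw [Finset.sum_congr rfl (g := fun _ => q ^ k * (1 - q) ^ (N - k)), Finset.sum_const,
      Finset.card_powersetCard, Finset.card_univ, Fintype.card_fin, nsmul_eq_mul]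
    · unfold binomMass
      ring
    · intro T hTk
      rw [hPT, (Finset.mem_powersetCard.1 hTk).2]
  · intro T _ T' _ hne
    exact Set.disjoint_left.2 fun s hs hs' => hne (hs.symm.trans hs')
  · exact fun T _ => hmeasT T

/-- An event that depends on the vote count alone has at most the corresponding binomial mass. -/
lemma measureReal_voteCount_le_sum {V Y S : Type*} [MeasurableSpace S] (P : Measure S)
    [IsProbabilityMeasure P] (base : List V → Y) (ψ : List V → ℝ) (x : List V) (N : ℕ)
    (E : Fin N → S → DelInd x) (hE : ∀ j, Measurable (E j))
    (hE_law : ∀ j ε, P.real {s | E j s = ε} = delMass ψ x ε) (hE_indep : iIndepFun E P) (y : Y)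
    (p : ℕ → Prop) [DecidablePred p] :
    P.real {s | p (voteCount base x (fun j => E j s) y)} ≤
      ∑ k ∈ (Finset.range (N + 1)).filter p, binomMass N (smoothedProb base ψ y x) k := by
  have h : {s | p (voteCount base x (fun j => E j s) y)} =
      ⋃ k ∈ (Finset.range (N + 1)).filter p,
        {s | voteCount base x (fun j => E j s) y = k} := by
    ext s
    have := voteCount_le base x (fun j => E j s) y
    simp only [Set.mem_ofPred_eq, Set.mem_iUnion, Finset.mem_filter, Finset.mem_range, exists_prop,
      exists_eq_right', Nat.lt_succ_of_le this, true_and]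
  rw [h]
  refine (measureReal_biUnion_finset_le _ _).trans_eq ?_
  exact Finset.sum_congr rfl fun k _ =>
    measureReal_voteCount_eq P base ψ x N E hE hE_law hE_indep y k

/-! ### Soundness of the certificate -/

/-- The confidence statement about the class `y`: the lower bound for `y` and the common upper
bound for the other classes are correct. -/
def BoundsCorrect {V Y : Type*} (base : List V → Y) (x : List V) (ψ : ℕ → ℝ) (α : ℝ) {N : ℕ}
    (e : Fin N → DelInd x) (y : Y) : Prop :=
  cpLower N (voteCount base x e y) (α / 2) ≤ smoothedProb base (fun z => ψ z.length) y x ∧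
    ∀ y' ≠ y, smoothedProb base (fun z => ψ z.length) y' x ≤
      ⨆ y' : {y' : Y // y' ≠ y}, cpUpper N (voteCount base x e y') (α / 2)

lemma smoothedProb_mem_Icc {V Y : Type*} (base : List V → Y) {ψ : ℕ → ℝ}
    (hψ : ∀ n, ψ n ∈ Set.Icc (0 : ℝ) 1) (y : Y) (x : List V) :
    smoothedProb base (fun z => ψ z.length) y x ∈ Set.Icc (0 : ℝ) 1 := by
  classical
  rw [smoothedProb_eq_delExp]
  exact ⟨delExp_nonneg (hψ _).1 (hψ _).2 (fun z => by split_ifs <;> norm_num) x,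
    delExp_le_one (hψ _).1 (hψ _).2 (fun z => by split_ifs <;> norm_num) x⟩

/-- No correction for the number of classes is needed: the common upper bound only has to be
correct for the runner-up, which does not depend on the sample. -/
lemma one_sub_le_measureReal_boundsCorrect {V Y S : Type*} [Finite Y] [MeasurableSpace S]
    (P : Measure S) [IsProbabilityMeasure P] (base : List V → Y) {ψ : ℕ → ℝ}
    (hψ : ∀ n, ψ n ∈ Set.Icc (0 : ℝ) 1) {α : ℝ} (hα : 0 ≤ α) (x : List V) (N : ℕ)
    (E : Fin N → S → DelInd x) (hE : ∀ j, Measurable (E j))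
    (hE_law : ∀ j ε, P.real {s | E j s = ε} = delMass (fun z => ψ z.length) x ε)
    (hE_indep : iIndepFun E P) (y : Y) :
    1 - α ≤ P.real {s | BoundsCorrect base x ψ α (fun j => E j s) y} := by
  classical
  set q : Y → ℝ := fun y => smoothedProb base (fun z => ψ z.length) y x with hq
  have hL : ∀ y, P.real {s | q y < cpLower N (voteCount base x (fun j => E j s) y) (α / 2)} ≤
      α / 2 := fun y =>
    (measureReal_voteCount_le_sum P base _ x N E hE hE_law hE_indep y
      (fun k => q y < cpLower N k (α / 2))).trans
      (sum_binomMass_cpLower_gt_le (smoothedProb_mem_Icc base hψ y x) (by linarith) N)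
  have hU : ∀ y, P.real {s | cpUpper N (voteCount base x (fun j => E j s) y) (α / 2) < q y} ≤
      α / 2 := fun y =>
    (measureReal_voteCount_le_sum P base _ x N E hE hE_law hE_indep y
      (fun k => cpUpper N k (α / 2) < q y)).trans
      (sum_binomMass_cpUpper_lt_le (smoothedProb_mem_Icc base hψ y x) (by linarith) N)
  set L := {s | q y < cpLower N (voteCount base x (fun j => E j s) y) (α / 2)}
  obtain ⟨U, hU1, hU2⟩ : ∃ U : Set S, P.real U ≤ α / 2 ∧ ∀ s, s ∉ U → ∀ y' ≠ y, q y' ≤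
      ⨆ y' : {y' : Y // y' ≠ y}, cpUpper N (voteCount base x (fun j => E j s) y') (α / 2) := by
    rcases isEmpty_or_nonempty {y' : Y // y' ≠ y} with he | hne
    · exact ⟨∅, by simpa using by linarith, fun s _ y' hy' => (he.false ⟨y', hy'⟩).elim⟩
    · obtain ⟨y₂, hy₂⟩ := Finite.exists_max fun y' : {y' : Y // y' ≠ y} => q y'
      refine ⟨_, hU y₂, fun s hs y' hy' => (hy₂ ⟨y', hy'⟩).trans ((not_lt.1 hs).trans ?_)⟩
      exact le_ciSup (f := fun y' : {y' : Y // y' ≠ y} =>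
        cpUpper N (voteCount base x (fun j => E j s) y') (α / 2)) (Set.finite_range _).bddAbove y₂
  have hcov : (Set.univ : Set S) ⊆
      {s | BoundsCorrect base x ψ α (fun j => E j s) y} ∪ (L ∪ U) := by
    intro s _
    by_cases h1 : s ∈ L
    · exact Or.inr (Or.inl h1)
    by_cases h2 : s ∈ U
    · exact Or.inr (Or.inr h2)
    exact Or.inl ⟨not_lt.1 h1, hU2 s h2⟩
  have h1 : (1 : ℝ) ≤ P.real {s | BoundsCorrect base x ψ α (fun j => E j s) y} +
      (P.real L + P.real U) := by
    calc (1 : ℝ) = P.real Set.univ := probReal_univ.symm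
      _ ≤ _ := measureReal_mono hcov
      _ ≤ _ := (measureReal_union_le _ _).trans
        (add_le_add_right (measureReal_union_le _ _) _)
  linarith [hL y]

/-- A radius covered by the search is `0`, or all checks up to it succeeded. -/
lemma eq_zero_or_not_checkFails_of_le_searchRadius {o : Set EditOp} {ψ : ℕ → ℝ} {n : ℕ}
    {t₁ t₂ : ℝ} {r : ℕ} (h : (r : ℕ∞) ≤ searchRadius o ψ n t₁ t₂) :
    r = 0 ∨ ∀ k ≤ r, ¬ CheckFails o ψ n t₁ t₂ k := by
  classical
  unfold searchRadius at h
  split_ifs at h with hex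
  · have h' : r ≤ Nat.find hex - 1 := by exact_mod_cast h
    rcases Nat.eq_zero_or_pos r with h0 | h0
    · exact Or.inl h0
    · exact Or.inr fun k hk => Nat.find_min hex (by omega)
  · exact Or.inr fun k _ hk => hex ⟨k, hk⟩

/-- At deletion rate `0` already the check at radius `0` fails; at a positive rate a successful
check separates the predicted class from all others on the whole ball. -/
theorem eq_of_mem_editBall_of_boundsCorrect {V Y : Type*} [Finite Y] {base : List V → Y}
    {ψ : ℕ → ℝ} (hψ : ∀ n, ψ n ∈ Set.Icc (0 : ℝ) 1) {f : List V → Y}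
    (hf : IsSmoothedClassifier base (fun z => ψ z.length) f) {o : Set EditOp} {α : ℝ}
    (hα : α < 1) {x : List V} {N : ℕ} {e : Fin N → DelInd x} {y : Y}
    (hgood : BoundsCorrect base x ψ α e y) {r : ℕ} (hr : (r : ℕ∞) ≤ certify base x y ψ o α e)
    {x' : List V} (hx' : x' ∈ editBall o r x) : f x = f x' := by
  classical
  obtain ⟨k, hkr, hch⟩ := exists_editChain_of_mem_editBall hx'
  unfold certify at hr
  obtain ⟨h₁, h₂⟩ := hgood
  set t₁ := cpLower N (voteCount base x e y) (α / 2)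
  set t₂ := ⨆ y' : {y' : Y // y' ≠ y}, cpUpper N (voteCount base x e y') (α / 2) with ht₂
  have hα2 : α / 2 < 1 := by linarith
  have ht₂0 : 0 ≤ t₂ := Real.iSup_nonneg fun _ => (cpUpper_pos _ _ hα2).le
  have ht₂1 : t₂ ≤ 1 := Real.iSup_le (fun _ => cpUpper_le_one _ _ _) zero_le_one
  have ht₂pos : ∀ y' ≠ y, 0 < t₂ := fun y' hy' => (cpUpper_pos N _ hα2).trans_le
    (le_ciSup (f := fun y' : {y' : Y // y' ≠ y} => cpUpper N (voteCount base x e y') (α / 2))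
      (Set.finite_range _).bddAbove ⟨y', hy'⟩)
  rcases eq_zero_or_not_checkFails_of_le_searchRadius hr with rfl | hpass
  · obtain rfl : k = 0 := Nat.le_zero.1 hkr
    rw [editChain_zero hch]
  have hp0 : 0 < ψ x.length := by
    refine (hψ x.length).1.lt_of_ne fun h0 => hpass 0 (Nat.zero_le r) ⟨0, 0, 0, ?_⟩
    refine ⟨by simp [editCounts], Nat.zero_le _, ?_⟩
    simp only [Nat.add_zero, Nat.sub_zero, ← h0]
    exact pairLB_zero_le_pairUB_zero _ (cpLower_lt_one (voteCount_le _ _ _ _) hα2) ht₂0 ht₂1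
  have main : ∀ z k', k' ≤ r → EditChain o k' x z → f z = y := by
    intro z k' hk' hz
    obtain ⟨nd, ni, ns, hk, hd, hi, hs, hlen, c, hcx, hcz, hc⟩ := hz.exists_counts
    by_contra hne
    have hlb := pairLB_le_delExp hp0 (hψ _).2 (hψ z.length).1 (hψ _).2
      (φ := fun v => if base v = y then 1 else 0) (fun v => by split_ifs <;> norm_num)
      (fun v => by split_ifs <;> norm_num) hcx hcz (h₁.trans_eq (smoothedProb_eq_delExp _ _ _ _))
    have hub := delExp_le_pairUB hp0 (hψ _).2 (hψ z.length).1 (hψ _).2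
      (φ := fun v => if base v = f z then 1 else 0) (fun v => by split_ifs <;> norm_num)
      (fun v => by split_ifs <;> norm_num) hcx hcz
      ((smoothedProb_eq_delExp _ _ _ _).symm.trans_le (h₂ (f z) hne)) (ht₂pos _ hne) ht₂1
    have hmax := hf z y
    rw [smoothedProb_eq_delExp, smoothedProb_eq_delExp] at hmax
    refine hpass (nd + ni + ns) (hk.trans hk') ⟨nd, ni, ns, ⟨rfl, hd, hi, hs⟩, by omega, ?_⟩
    rw [show x.length + ni - nd = z.length by omega, show x.length - nd - ns = c.length by omega]
    exact hlb.trans (hmax.trans hub)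
  rw [main x 0 (Nat.zero_le _) (EditChain.refl x), main x' k hkr hch]

end Sampling

open MeasureTheory ProbabilityTheory in
theorem mainTheorem3 {V Y S : Type*} [Finite Y] [MeasurableSpace Y] [MeasurableSingletonClass Y]
    [MeasurableSpace S] (P : Measure S) [IsProbabilityMeasure P]
    (base : List V → Y) (ψ : ℕ → ℝ) (hψ : ∀ n, ψ n ∈ Set.Icc (0 : ℝ) 1)
    (f : List V → Y) (hf : IsSmoothedClassifier base (fun z => ψ z.length) f)
    (o : Set EditOp) (α : ℝ) (hα : α ∈ Set.Ioo (0 : ℝ) 1) (x : List V)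
    (N : ℕ) (E : Fin N → S → DelInd x) (hE : ∀ j, Measurable (E j))
    (hE_law : ∀ j ε, P.real {s | E j s = ε} = delMass (fun z => ψ z.length) x ε)
    (hE_indep : iIndepFun E P)
    (y₁ : S → Y) (hy₁ : Measurable y₁)
    (hy₁_indep : IndepFun y₁ (fun s j => E j s) P) :
    1 - α ≤ P.real {s | ∀ r : ℕ,
      (r : ℕ∞) ≤ certify base x (y₁ s) ψ o α (fun j => E j s) →
        ∀ x' ∈ editBall o r x, f x = f x'} := by
  classical
  have := Fintype.ofFinite Y
  let G : Y → Set (Fin N → DelInd x) := fun y => {e | BoundsCorrect base x ψ α e y}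
  have hG : ∀ y, MeasurableSet (G y) := fun y => (Set.toFinite (G y)).measurableSet
  have hEm : Measurable fun s j => E j s := measurable_pi_lambda _ hE
  have hdisj : ∀ F : Y → Set S,
      Set.PairwiseDisjoint (↑(Finset.univ : Finset Y)) fun y => y₁ ⁻¹' {y} ∩ F y :=
    fun F y _ y' _ hne =>
      Set.disjoint_left.2 fun s hs hs' => hne (hs.1.symm.trans hs'.1)
  have htotal : ∑ y, P.real (y₁ ⁻¹' {y}) = 1 := by
    have h := measureReal_biUnion_finset (μ := P) (hdisj fun _ => Set.univ)
      fun y _ => (hy₁ (measurableSet_singleton y)).inter MeasurableSet.univ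
    simp only [Set.inter_univ] at h
    rw [← h, ← probReal_univ (μ := P)]
    congr 1
    ext s
    simp
  calc 1 - α = ∑ y, P.real (y₁ ⁻¹' {y}) * (1 - α) := by rw [← Finset.sum_mul, htotal, one_mul]
    _ ≤ ∑ y, P.real (y₁ ⁻¹' {y}) * P.real ((fun s j => E j s) ⁻¹' G y) :=
      Finset.sum_le_sum fun y _ => mul_le_mul_of_nonneg_left
        (one_sub_le_measureReal_boundsCorrect P base hψ hα.1.le x N E hE hE_law hE_indep y)
        measureReal_nonneg
    _ = ∑ y, P.real (y₁ ⁻¹' {y} ∩ (fun s j => E j s) ⁻¹' G y) := by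
      refine Finset.sum_congr rfl fun y _ => ?_
      rw [measureReal_def, measureReal_def, measureReal_def,
        hy₁_indep.measure_inter_preimage_eq_mul _ _ (measurableSet_singleton y) (hG y),
        ENNReal.toReal_mul]
    _ = P.real (⋃ y ∈ Finset.univ, y₁ ⁻¹' {y} ∩ (fun s j => E j s) ⁻¹' G y) :=
      (measureReal_biUnion_finset (hdisj _) fun y _ =>
        (hy₁ (measurableSet_singleton y)).inter (hEm (hG y))).symm
    _ ≤ _ := by
      refine measureReal_mono fun s hs r hr x' hx' => ?_
      obtain ⟨y, _, hy, hs⟩ := Set.mem_iUnion₂.1 hs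
      obtain rfl : y₁ s = y := hy
      exact eq_of_mem_editBall_of_boundsCorrect hψ hf hα.2 hs hr hx'
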